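/- For real $y$, a positive integer $d$ and an integer $a$, let $\pi(y)$ be the number of primes $p\le y$ and $\pi(y;d,a)$ the number of primes $p\le y$ with $p\equiv a\pmod d$. Let $\mathcal B$ be the set of real numbers $B$ with $0<B<1$ for which there are a real number $x_2(B)$ and a positive integer $D_B$ with the following property: for every real $x\ge x_2(B)$ there is a set $\mathcal D_B(x)$ of at most $D_B$ integers, each exceeding $\log x$, such that $$\pi(y;d,a)\ \ge\ \frac{\pi(y)}{2\varphi(d)}$$ for all real $y$ and all integers $a,d$ with $(a,d)=1$ and $1\le d\le\min\{x^B,\,y/x^{1-B}\}$ such that $d$ is not divisible by any member of $\mathcal D_B(x)$. **Theorem.** Let $B\in\mathcal B$, let $D_B$ be any positive integer with the above property, and let $a$ be a fixed non-zero integer. There is a number $x_3$ (depending on $B$, $D_B$ and $a$) such that the following holds for every real $x\ge x_3$. If $L$ is a squarefree positive integer not divisible by any prime exceeding $x^{(1-B)/2}$ and $$\sum_{\substack{q\mid L\\ q\text{ prime}}}\frac1q\ \le\ \frac{1-B}{32},$$ then there is a positive integer $k\le x^{1-B}+|a|$ with $(k,aL)=1$ such that $$\#\{d\mid L:\ dk+a\le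 x,\ dk+a\text{ is prime}\}\ \ge\ \frac{2^{-D_B-\omega(a)-3}}{\log x}\,\#\{d\mid L:\ 1\le d\le x^B\},$$ where $d$ runs over positive divisors and $\omega(a)$ is the number of distinct prime factors of $|a|$. -/

import Mathlib

/-- `π(y; d, a)`: the number of primes `p ≤ y` with `p ≡ a (mod d)`. -/
noncomputable def primeCountAP (y : ℝ) (d : ℕ) (a : ℤ) : ℕ :=
  ((Finset.Iic ⌊y⌋₊).filter (fun p : ℕ => p.Prime ∧ (p : ℤ) ≡ a [ZMOD (d : ℤ)])).card

/-- The positive integer `D` can serve as `D_B`: for all large `x` there is an exceptional set `𝒟`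
(depending on `x` only) of at most `D` integers, each exceeding `log x`, such that
`π(y; d, a) ≥ π(y) / (2 φ(d))` for all `y`, `a` and `d` with `(a, d) = 1`,
`1 ≤ d ≤ min (x ^ B) (y / x ^ (1 - B))` and `d` divisible by no member of `𝒟`. -/
def IsExceptionalBound (B : ℝ) (D : ℕ) : Prop :=
  0 < D ∧ ∃ x₂ : ℝ, ∀ x : ℝ, x₂ ≤ x →
    ∃ 𝒟 : Finset ℕ, 𝒟.card ≤ D ∧ (∀ m ∈ 𝒟, Real.log x < (m : ℝ)) ∧
      ∀ (y : ℝ) (a : ℤ) (d : ℕ), IsCoprime a (d : ℤ) → 1 ≤ d →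
        (d : ℝ) ≤ min (x ^ B) (y / x ^ (1 - B)) →
        (∀ m ∈ 𝒟, ¬ m ∣ d) →
        (Nat.primeCounting ⌊y⌋₊ : ℝ) / (2 * (Nat.totient d : ℝ)) ≤ (primeCountAP y d a : ℝ)

/-- The set `𝓑` of admissible exponents. -/
def admissibleExponents : Set ℝ :=
  {B | 0 < B ∧ B < 1 ∧ ∃ D : ℕ, IsExceptionalBound B D}

/-! Put `X = x ^ (1 - B)`, and let `G` be the set of divisors `d ≤ x ^ B` of `L` that avoid the
primes of `a` and one chosen prime factor of each exceptional modulus. Every `d ∈ G` is then coprime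
to `a` and divisible by no exceptional modulus. The defining property of `B` at `y = d * X`, with
Chebyshev's bound for `π(y)`, gives at least `0.34 * W` primes `p ≤ d * X` with `p ≡ a` modulo `d`,
where `W = d * X / (φ(d) log x)`.

Each such `p > |a|` yields `k = (p - a) / d ≤ X + |a|`, automatically coprime to `a`. A common prime
factor `q` of `k` and `L` puts `p` in the class of `a` modulo `d * q`. Brun–Titchmarsh bounds these
primes by a multiple of `W / q`, and the hypothesis on `∑ 1 / q` makes the total at most `0.17 * W`.
At most `0.01 * W` is lost to `p ≤ |a|`, so at least `0.16 * X / log x` values of `k` remain for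
each `d` (`le_card_primes_quotient_coprime`, `card_primes_le_card_multipliers`).

Pigeonholing over the at most `1.01 * X` candidates `k` gives one that serves at least `#G / (8 log
x)` divisors. Avoiding at most `D + ω(a)` primes costs a factor of at most `2 ^ (D + ω(a))`
(`card_divisors_le_two_pow_mul`). Brun–Titchmarsh itself is derived from Selberg's sieve. -/

namespace BoundingSieve

/-! ### Selberg's upper bound sieve -/

open Finset Nat ArithmeticFunction
open scoped ArithmeticFunction.Moebius

/-- The sum `∑ g(l)` over the divisors `l ≤ z` of the sifting product. -/
noncomputable def selbergSum (s : BoundingSieve) (z : ℝ) : ℝ :=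
  ∑ l ∈ s.prodPrimes.divisors with ((l : ℕ) : ℝ) ≤ z, s.selbergTerms l

/-- Selberg's optimal weights of support `d ≤ z`. -/
noncomputable def selbergWeights (s : BoundingSieve) (z : ℝ) (d : ℕ) : ℝ :=
  (s.nu d)⁻¹ * μ d *
    (∑ l ∈ s.prodPrimes.divisors with ((l : ℕ) : ℝ) ≤ z, if d ∣ l then s.selbergTerms l else 0) /
      s.selbergSum z

/-- Writing `d = l * e` with `e ∣ k / l` factors out `μ l` and leaves a complete Möbius sum. This is
the inversion that diagonalises Selberg's quadratic form. -/
theorem sum_moebius_between_of_squarefree {P k l : ℕ} (hP : Squarefree P) (hk : k ∣ P) :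
    (∑ d ∈ P.divisors, if l ∣ d ∧ d ∣ k then (μ d : ℝ) else 0) =
      if k = l then (μ l : ℝ) else 0 := by
  have hP0 := hP.ne_zero
  have hk0 : k ≠ 0 := ne_zero_of_dvd_ne_zero hP0 hk
  by_cases hlk : l ∣ k
  · obtain ⟨j, rfl⟩ := hlk
    have hsq : Squarefree (l * j) := hP.squarefree_of_dvd hk
    have hcop : l.Coprime j := coprime_of_squarefree_mul hsq
    have hl0 : l ≠ 0 := left_ne_zero_of_mul hk0
    have hj0 : j ≠ 0 := right_ne_zero_of_mul hk0
    have hset : P.divisors.filter (fun d => l ∣ d ∧ d ∣ l * j) =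
        j.divisors.image (fun e => l * e) := by
      ext d
      simp only [mem_filter, mem_divisors, mem_image]
      constructor
      · rintro ⟨-, ⟨e, rfl⟩, h⟩
        exact ⟨e, ⟨Nat.dvd_of_mul_dvd_mul_left (Nat.pos_of_ne_zero hl0) h, hj0⟩, rfl⟩
      · rintro ⟨e, ⟨he, -⟩, rfl⟩
        have := Nat.mul_dvd_mul_left l he
        exact ⟨⟨this.trans hk, hP0⟩, dvd_mul_right _ _, this⟩
    rw [← sum_filter, hset, sum_image (fun x _ y _ h => Nat.eq_of_mul_eq_mul_left
      (Nat.pos_of_ne_zero hl0) h)]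
    have h1 : ∀ e ∈ j.divisors, (μ (l * e) : ℝ) = μ l * μ e := fun e he => by
      rw [isMultiplicative_moebius.map_mul_of_coprime
        (hcop.coprime_dvd_right (dvd_of_mem_divisors he))]
      push_cast; rfl
    rw [sum_congr rfl h1, ← mul_sum]
    have h2 : (∑ e ∈ j.divisors, (μ e : ℝ)) = if j = 1 then 1 else 0 := by
      have := congrArg (fun f : ArithmeticFunction ℤ => f j) coe_zeta_mul_moebius
      simp only [coe_zeta_mul_apply, one_apply] at this
      exact_mod_cast congrArg (Int.cast : ℤ → ℝ) this
    rw [h2]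
    by_cases hj : j = 1
    · simp [hj]
    · have : l * j ≠ l := fun h => hj (Nat.eq_of_mul_eq_mul_left (Nat.pos_of_ne_zero hl0)
        (by rw [h, mul_one]))
      rw [if_neg hj, if_neg this, mul_zero]
  · have h1 : k ≠ l := fun h => hlk (h ▸ dvd_rfl)
    rw [if_neg h1]
    refine sum_eq_zero fun d _ => if_neg fun h => hlk (h.1.trans h.2)

variable (s : BoundingSieve) {z : ℝ}

theorem one_le_selbergSum (hz : 1 ≤ z) : 1 ≤ s.selbergSum z := by
  have h1 : (1 : ℝ) = s.selbergTerms 1 := s.selbergTerms_isMultiplicative.map_one.symm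
  rw [h1, selbergSum]
  refine single_le_sum (f := fun l => s.selbergTerms l) (fun l hl => ?_) ?_
  · exact (s.selbergTerms_pos (dvd_of_mem_divisors (mem_filter.1 hl).1)).le
  · simpa [s.prodPrimes_ne_zero] using hz

theorem selbergWeights_one (hz : 1 ≤ z) : s.selbergWeights z 1 = 1 := by
  have := s.one_le_selbergSum hz
  have h : s.selbergSum z ≠ 0 := by linarith
  simp only [selbergWeights, s.nu_mult.map_one, one_dvd, if_true]
  simp only [moebius_apply_one]
  rw [← selbergSum]
  field_simp
  simp

theorem selbergWeights_eq_zero {d : ℕ} (hd : z < d) : s.selbergWeights z d = 0 := by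
  have : (∑ l ∈ s.prodPrimes.divisors with ((l : ℕ) : ℝ) ≤ z,
      if d ∣ l then s.selbergTerms l else 0) = 0 := by
    refine sum_eq_zero fun l hl => if_neg fun h => ?_
    rw [mem_filter, mem_divisors] at hl
    have h1 : d ≤ l := Nat.le_of_dvd (Nat.pos_of_ne_zero
      (ne_zero_of_dvd_ne_zero hl.1.2 hl.1.1)) h
    have h2 : (d : ℝ) ≤ l := by exact_mod_cast h1
    linarith [hl.2]
  simp [selbergWeights, this]

/-- These sums are the diagonal variables of the quadratic form. The weights are the Möbius inverse
of the optimal choice, proportional to `μ l * g(l)` on `l ≤ z`. -/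
theorem sum_nu_mul_selbergWeights {l : ℕ} (hl : l ∣ s.prodPrimes) :
    (∑ d ∈ s.prodPrimes.divisors, if l ∣ d then s.nu d * s.selbergWeights z d else 0) =
      if (l : ℝ) ≤ z then μ l * s.selbergTerms l / s.selbergSum z else 0 := by
  have h1 : ∀ d ∈ s.prodPrimes.divisors,
      (if l ∣ d then s.nu d * s.selbergWeights z d else 0) =
      ∑ k ∈ s.prodPrimes.divisors with ((k : ℕ) : ℝ) ≤ z,
        (s.selbergTerms k / s.selbergSum z) * if l ∣ d ∧ d ∣ k then (μ d : ℝ) else 0 := by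
    intro d hd
    have hnu : s.nu d ≠ 0 := s.nu_ne_zero (dvd_of_mem_divisors hd)
    by_cases hld : l ∣ d
    · simp only [hld, if_true, true_and, selbergWeights]
      rw [mul_sum, sum_div, mul_sum]
      refine sum_congr rfl fun k _ => ?_
      split_ifs
      · field_simp
      · simp
    · simp [hld]
  rw [sum_congr rfl h1, sum_comm]
  simp_rw [← mul_sum]
  rw [sum_congr rfl fun k hk => by
    rw [sum_moebius_between_of_squarefree s.prodPrimes_squarefree
      (dvd_of_mem_divisors (mem_filter.1 hk).1)]]
  simp only [mul_ite, mul_zero]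
  rw [sum_ite_eq' _ l (fun k => s.selbergTerms k / s.selbergSum z * (μ l : ℝ))]
  simp only [mem_filter, mem_divisors, hl, s.prodPrimes_ne_zero, ne_eq, not_false_eq_true,
    true_and]
  split_ifs <;> ring

theorem mainSum_selbergWeights (hz : 1 ≤ z) :
    s.mainSum (lambdaSquared (s.selbergWeights z)) = (s.selbergSum z)⁻¹ := by
  have hS : s.selbergSum z ≠ 0 := by linarith [s.one_le_selbergSum hz]
  rw [mainSum_lambdaSquared_eq_sum_mul_sum_sq]
  have h1 : ∀ l ∈ s.prodPrimes.divisors, (s.selbergTerms l)⁻¹ *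
      (∑ d ∈ s.prodPrimes.divisors, if l ∣ d then s.nu d * s.selbergWeights z d else 0) ^ 2 =
      if (l : ℝ) ≤ z then s.selbergTerms l / s.selbergSum z ^ 2 else 0 := by
    intro l hl
    have hl' := dvd_of_mem_divisors hl
    rw [s.sum_nu_mul_selbergWeights hl']
    have hg : s.selbergTerms l ≠ 0 := (s.selbergTerms_pos hl').ne'
    have hμ : (μ l : ℝ) ^ 2 = 1 := by
      exact_mod_cast moebius_sq_eq_one_of_squarefree (s.squarefree_of_dvd_prodPrimes hl')
    split_ifs
    · rw [div_pow, mul_pow, hμ]; field_simp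
    · simp
  rw [sum_congr rfl h1, ← sum_filter, ← sum_div, ← selbergSum]
  field_simp

/-- Selberg's weights are bounded by `1`. -/
theorem abs_selbergWeights_le_one (hz : 1 ≤ z) {d : ℕ} (hd : d ∣ s.prodPrimes) :
    |s.selbergWeights z d| ≤ 1 := by
  have hS : 0 < s.selbergSum z := by linarith [s.one_le_selbergSum hz]
  have hP0 := s.prodPrimes_ne_zero
  have hd0 : d ≠ 0 := ne_zero_of_dvd_ne_zero hP0 hd
  have hdpos : 0 < d := Nat.pos_of_ne_zero hd0
  have hnu := s.nu_pos_of_dvd_prodPrimes hd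
  have hμ : |(μ d : ℝ)| = 1 := by
    exact_mod_cast abs_moebius_eq_one_of_squarefree (s.squarefree_of_dvd_prodPrimes hd)
  set T := s.prodPrimes.divisors.filter (fun l : ℕ => (l : ℝ) ≤ z) with hT
  set G := ∑ m ∈ s.prodPrimes.divisors with d.Coprime m ∧ ((d * m : ℕ) : ℝ) ≤ z,
    s.selbergTerms m with hG
  have hmulP : ∀ {k m : ℕ}, k ∣ s.prodPrimes → m ∣ s.prodPrimes → k.Coprime m →
      k * m ∣ s.prodPrimes := fun hk hm h => h.mul_dvd_of_dvd_of_dvd hk hm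
  have hsum : (∑ l ∈ T, if d ∣ l then s.selbergTerms l else 0) = s.selbergTerms d * G := by
    rw [← sum_filter, hG, mul_sum]
    symm
    refine sum_bij (fun m _ => d * m) ?_ ?_ ?_ ?_
    · intro m hm
      simp only [mem_filter, mem_divisors, hT] at hm ⊢
      exact ⟨⟨⟨hmulP hd hm.1.1 hm.2.1, hP0⟩, hm.2.2⟩, dvd_mul_right _ _⟩
    · intro m _ m' _ h
      exact Nat.eq_of_mul_eq_mul_left hdpos h
    · intro l hl
      simp only [mem_filter, mem_divisors, hT] at hl
      obtain ⟨⟨⟨hlP, -⟩, hlz⟩, m, rfl⟩ := hl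
      refine ⟨m, ?_, rfl⟩
      simp only [mem_filter, mem_divisors]
      exact ⟨⟨(dvd_mul_left _ _).trans hlP, hP0⟩,
        coprime_of_squarefree_mul (s.squarefree_of_dvd_prodPrimes hlP), hlz⟩
    · intro m hm
      simp only [mem_filter] at hm
      rw [s.selbergTerms_isMultiplicative.map_mul_of_coprime hm.2.1]
  -- Since `g(d) / ν(d) = ∑ g(k)` over `k ∣ d`, the left side is a sum of `g(k * m)` with `m`
  -- coprime to `d` and `k * m ≤ d * m ≤ z`. The products `k * m` are distinct, as `k = gcd(k * m,
  -- d)`.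
  have hle : s.selbergTerms d * (s.nu d)⁻¹ * G ≤ s.selbergSum z := by
    rw [← s.sum_divisors_selbergTerms_eq_selbergTerms_mul_nu_inv hd, ← sum_filter,
      Nat.divisors_filter_dvd_of_dvd hP0 hd, hG, sum_mul_sum, ← sum_product']
    have hinj : Set.InjOn (fun x : ℕ × ℕ => x.1 * x.2)
        (d.divisors ×ˢ s.prodPrimes.divisors.filter
          (fun m => d.Coprime m ∧ ((d * m : ℕ) : ℝ) ≤ z) : Finset (ℕ × ℕ)) := by
      rintro ⟨k, m⟩ h ⟨k', m'⟩ h' heq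
      simp only [coe_product, Set.mem_prod, mem_coe, mem_divisors, mem_filter] at h h' heq
      have hk : (k * m).gcd d = k := by
        rw [Nat.gcd_comm, Nat.Coprime.gcd_mul_right_cancel_right k h.2.2.1.symm]
        exact Nat.gcd_eq_right h.1.1
      have hk' : (k' * m').gcd d = k' := by
        rw [Nat.gcd_comm, Nat.Coprime.gcd_mul_right_cancel_right k' h'.2.2.1.symm]
        exact Nat.gcd_eq_right h'.1.1
      have hkk : k = k' := by rw [← hk, heq, hk']
      subst hkk
      have : m = m' := Nat.eq_of_mul_eq_mul_left
        (Nat.pos_of_ne_zero (ne_zero_of_dvd_ne_zero hd0 h.1.1)) heq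
      rw [this]
    calc _ = ∑ x ∈ d.divisors ×ˢ s.prodPrimes.divisors.filter
          (fun m => d.Coprime m ∧ ((d * m : ℕ) : ℝ) ≤ z), s.selbergTerms (x.1 * x.2) := by
          refine sum_congr rfl fun x hx => ?_
          simp only [mem_product, mem_divisors, mem_filter] at hx
          rw [s.selbergTerms_isMultiplicative.map_mul_of_coprime
            (hx.2.2.1.coprime_dvd_left hx.1.1)]
      _ = ∑ l ∈ (d.divisors ×ˢ s.prodPrimes.divisors.filter
          (fun m => d.Coprime m ∧ ((d * m : ℕ) : ℝ) ≤ z)).image (fun x : ℕ × ℕ => x.1 * x.2),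
            s.selbergTerms l := (sum_image hinj).symm
      _ ≤ s.selbergSum z := by
          rw [selbergSum]
          refine sum_le_sum_of_subset_of_nonneg ?_ ?_
          · intro l hl
            simp only [mem_image, mem_product, mem_divisors, mem_filter] at hl ⊢
            obtain ⟨⟨k, m⟩, ⟨⟨hk, -⟩, ⟨hm, -⟩, hc, hz'⟩, rfl⟩ := hl
            refine ⟨⟨hmulP (hk.trans hd) hm (hc.coprime_dvd_left hk), hP0⟩, le_trans ?_ hz'⟩
            exact_mod_cast Nat.mul_le_mul_right m (Nat.le_of_dvd hdpos hk)
          · intro l hl _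
            exact (s.selbergTerms_pos (dvd_of_mem_divisors (mem_filter.1 hl).1)).le
  have hGnn : 0 ≤ G := sum_nonneg fun m hm =>
    (s.selbergTerms_pos (dvd_of_mem_divisors (mem_filter.1 hm).1)).le
  have hg := s.selbergTerms_pos hd
  rw [selbergWeights, hsum, abs_div, abs_mul, abs_mul, hμ, mul_one, abs_of_pos (inv_pos.2 hnu),
    abs_of_pos hS, abs_of_nonneg (mul_nonneg hg.le hGnn), div_le_one hS]
  calc _ = s.selbergTerms d * (s.nu d)⁻¹ * G := by ring
    _ ≤ _ := hle

/-- Each pair `(d1, d2)` contributes only to `d = lcm(d1, d2)`. -/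
theorem sum_abs_lambdaSquared_le (w : ℕ → ℝ) :
    ∑ d ∈ s.prodPrimes.divisors, |lambdaSquared w d| ≤
      (∑ d ∈ s.prodPrimes.divisors, |w d|) ^ 2 := by
  have hP0 := s.prodPrimes_ne_zero
  calc _ ≤ ∑ d ∈ s.prodPrimes.divisors, ∑ d1 ∈ s.prodPrimes.divisors,
        ∑ d2 ∈ s.prodPrimes.divisors, if d = d1.lcm d2 then |w d1| * |w d2| else 0 := by
        refine sum_le_sum fun d hd => ?_
        have hsub : d.divisors ⊆ s.prodPrimes.divisors :=
          Nat.divisors_subset_of_dvd hP0 (dvd_of_mem_divisors hd)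
        have hnn : ∀ d1 d2 : ℕ, 0 ≤ if d = d1.lcm d2 then |w d1| * |w d2| else 0 := by
          intro d1 d2; split_ifs <;> positivity
        rw [lambdaSquared]
        refine (abs_sum_le_sum_abs _ _).trans ?_
        refine le_trans (sum_le_sum fun d1 _ => ?_)
          (sum_le_sum_of_subset_of_nonneg hsub fun d1 _ _ => sum_nonneg fun d2 _ => hnn d1 d2)
        refine (abs_sum_le_sum_abs _ _).trans ?_
        refine le_trans (sum_le_sum fun d2 _ => ?_)
          (sum_le_sum_of_subset_of_nonneg hsub fun d2 _ _ => hnn d1 d2)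
        split_ifs <;> simp [abs_mul]
    _ = ∑ d1 ∈ s.prodPrimes.divisors, ∑ d2 ∈ s.prodPrimes.divisors, |w d1| * |w d2| := by
        rw [sum_comm]
        refine sum_congr rfl fun d1 h1 => ?_
        rw [sum_comm]
        refine sum_congr rfl fun d2 h2 => ?_
        rw [sum_ite_eq_of_mem']
        exact mem_divisors.2 ⟨Nat.lcm_dvd (dvd_of_mem_divisors h1) (dvd_of_mem_divisors h2), hP0⟩
    _ = _ := by rw [sq, sum_mul_sum]

/-- Selberg's upper bound sieve for remainders bounded by `1`. -/
theorem siftedSum_le_div_selbergSum_add_sq (hz : 1 ≤ z)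
    (hrem : ∀ d, d ∣ s.prodPrimes → |s.rem d| ≤ 1) :
    s.siftedSum ≤ s.totalMass / s.selbergSum z + z ^ 2 := by
  refine (s.siftedSum_le_mainSum_errSum_of_upperMoebius _
    (upperMoebius_lambdaSquared _ (s.selbergWeights_one hz))).trans ?_
  rw [s.mainSum_selbergWeights hz, div_eq_mul_inv]
  gcongr
  calc s.errSum _ ≤ ∑ d ∈ s.prodPrimes.divisors, |lambdaSquared (s.selbergWeights z) d| := by
        refine sum_le_sum fun d hd => ?_
        exact mul_le_of_le_one_right (abs_nonneg _) (hrem d (dvd_of_mem_divisors hd))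
    _ ≤ (∑ d ∈ s.prodPrimes.divisors, |s.selbergWeights z d|) ^ 2 :=
        s.sum_abs_lambdaSquared_le _
    _ ≤ z ^ 2 := by
        gcongr
        calc _ ≤ ∑ d ∈ s.prodPrimes.divisors, (if (d : ℝ) ≤ z then (1 : ℝ) else 0) := by
              refine sum_le_sum fun d hd => ?_
              split_ifs with h
              · exact s.abs_selbergWeights_le_one hz (dvd_of_mem_divisors hd)
              · rw [s.selbergWeights_eq_zero (not_le.1 h), abs_zero]
          _ = ((s.prodPrimes.divisors.filter (fun d : ℕ => (d : ℝ) ≤ z)).card : ℝ) := by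
              rw [← sum_filter]; simp
          _ ≤ ((Finset.Icc 1 ⌊z⌋₊).card : ℝ) := by
              gcongr
              intro d hd
              simp only [mem_filter, mem_Icc] at hd ⊢
              exact ⟨Nat.pos_of_mem_divisors hd.1, Nat.le_floor hd.2⟩
          _ ≤ z := by
              simpa using Nat.floor_le (by linarith : (0 : ℝ) ≤ z)

end BoundingSieve

/-! ### Brun–Titchmarsh and Chebyshev bounds -/

open Finset Filter

/-- A finite sum of reciprocals of numbers composed of the primes of `s` is at most the
Euler product. -/
theorem sum_inv_le_prod_of_mem_factoredNumbers (s A : Finset ℕ) (hs : ∀ p ∈ s, p.Prime)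
    (hA : ∀ m ∈ A, m ∈ Nat.factoredNumbers s) :
    ∑ m ∈ A, (m : ℝ)⁻¹ ≤ ∏ p ∈ s, (1 - (p : ℝ)⁻¹)⁻¹ := by
  let f : ℕ →* ℝ :=
    { toFun := fun m => (m : ℝ)⁻¹
      map_one' := by simp
      map_mul' := fun a b => by push_cast; rw [mul_inv] }
  have hf : ∀ {p : ℕ}, p.Prime → ‖f p‖ < 1 := by
    intro p hp
    have : (1 : ℝ) < p := by exact_mod_cast hp.one_lt
    change ‖(p : ℝ)⁻¹‖ < 1
    rw [norm_inv, Real.norm_natCast]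
    exact inv_lt_one_of_one_lt₀ this
  have h := (EulerProduct.summable_and_hasSum_factoredNumbers_prod_filter_prime_geometric hf s).2
  rw [filter_true_of_mem hs] at h
  have := sum_le_hasSum (A.subtype (· ∈ Nat.factoredNumbers s))
    (fun m _ => by change (0 : ℝ) ≤ ((m : ℕ) : ℝ)⁻¹; positivity) h
  refine le_trans (le_of_eq ?_) this
  exact (sum_subtype_of_mem (fun m : ℕ => (m : ℝ)⁻¹) hA).symm

theorem prod_inv_one_sub_inv_primeFactors {n : ℕ} (hn : n ≠ 0) :
    ∏ p ∈ n.primeFactors, (1 - (p : ℝ)⁻¹)⁻¹ = n / n.totient := by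
  have h : (n.totient : ℝ) = n * ∏ p ∈ n.primeFactors, (1 - (p : ℝ)⁻¹) := by
    have := congrArg (Rat.cast : ℚ → ℝ) (Nat.totient_eq_mul_prod_factors n)
    push_cast at this
    exact this
  have h0 : (n : ℝ) ≠ 0 := by exact_mod_cast hn
  have h1 : (n.totient : ℝ) ≠ 0 := by
    exact_mod_cast (Nat.totient_pos.2 (Nat.pos_of_ne_zero hn)).ne'
  have h2 : ∏ p ∈ n.primeFactors, (1 - (p : ℝ)⁻¹) ≠ 0 := fun h' => h1 (by rw [h, h', mul_zero])
  rw [prod_inv_distrib, eq_div_iff h1, h, mul_left_comm, inv_mul_cancel₀ h2, mul_one]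

/-- The density function `d ↦ 1 / d`. -/
noncomputable def invDensity : ArithmeticFunction ℝ := ⟨fun d => (d : ℝ)⁻¹, by simp⟩

theorem invDensity_apply (d : ℕ) : invDensity d = (d : ℝ)⁻¹ := rfl

theorem invDensity_isMultiplicative : invDensity.IsMultiplicative := by
  refine ⟨by simp [invDensity_apply], fun {m n} _ => ?_⟩
  simp [invDensity_apply, mul_comm]

/-- The primes up to `z` that do not divide `n`. -/
noncomputable def siftingPrimes (n : ℕ) (z : ℝ) : Finset ℕ :=
  (Icc 1 ⌊z⌋₊).filter (fun p => p.Prime ∧ ¬ p ∣ n)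

theorem mem_siftingPrimes {n : ℕ} {z : ℝ} {p : ℕ} :
    p ∈ siftingPrimes n z ↔ p ≤ ⌊z⌋₊ ∧ p.Prime ∧ ¬ p ∣ n := by
  simp only [siftingPrimes, mem_filter, mem_Icc]
  exact ⟨fun h => ⟨h.1.2, h.2⟩, fun h => ⟨⟨h.2.1.one_le, h.1⟩, h.2⟩⟩

theorem squarefree_prod_primes (s : Finset ℕ) (hs : ∀ p ∈ s, p.Prime) :
    Squarefree (∏ p ∈ s, p) :=
  squarefree_prod_of_pairwise_isCoprime (f := fun p : ℕ => p)
    (fun p hp q hq hpq => (Nat.coprime_iff_isRelPrime.1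
      ((Nat.coprime_primes (hs p hp) (hs q hq)).2 hpq)))
    (fun p hp => (hs p hp).squarefree)

theorem prime_dvd_prod_primes_iff {s : Finset ℕ} (hs : ∀ p ∈ s, p.Prime) {q : ℕ}
    (hq : q.Prime) : q ∣ ∏ p ∈ s, p ↔ q ∈ s := by
  rw [hq.prime.dvd_finsetProd_iff]
  constructor
  · rintro ⟨p, hp, h⟩
    rwa [(Nat.prime_dvd_prime_iff_eq hq (hs p hp)).1 h]
  · exact fun h => ⟨q, h, dvd_rfl⟩

/-- The sieve for the terms `b + n * m`, `m < N`, by the primes up to `z` not dividing `n`. -/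
noncomputable def progressionSieve (n b N : ℕ) (z : ℝ) : BoundingSieve where
  support := (range N).image (fun m => b + n * m)
  prodPrimes := ∏ p ∈ siftingPrimes n z, p
  prodPrimes_squarefree := squarefree_prod_primes _ fun _ hp => (mem_siftingPrimes.1 hp).2.1
  weights := fun _ => 1
  weights_nonneg := fun _ => zero_le_one
  totalMass := N
  nu := invDensity
  nu_mult := invDensity_isMultiplicative
  nu_pos_of_prime := fun p hp _ => by
    rw [invDensity_apply]; exact inv_pos.2 (by exact_mod_cast hp.pos)
  nu_lt_one_of_prime := fun p hp _ => by
    rw [invDensity_apply]; exact inv_lt_one_of_one_lt₀ (by exact_mod_cast hp.one_lt)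

theorem prime_dvd_prodPrimes_progressionSieve {n b N : ℕ} {z : ℝ} {p : ℕ} (hp : p.Prime) :
    p ∣ (progressionSieve n b N z).prodPrimes ↔ p ≤ ⌊z⌋₊ ∧ ¬ p ∣ n := by
  have := prime_dvd_prod_primes_iff (s := siftingPrimes n z)
    (fun _ h => (mem_siftingPrimes.1 h).2.1) hp
  rw [mem_siftingPrimes] at this
  exact this.trans ⟨fun h => ⟨h.1, h.2.2⟩, fun h => ⟨h.1, hp, h.2⟩⟩

theorem coprime_of_dvd_prodPrimes_progressionSieve {n b N : ℕ} {z : ℝ} {d : ℕ}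
    (hd : d ∣ (progressionSieve n b N z).prodPrimes) : d.Coprime n := by
  refine Nat.Coprime.symm (Nat.coprime_of_dvd fun p hp hpn hpd => ?_)
  exact ((prime_dvd_prodPrimes_progressionSieve hp).1 (hpd.trans hd)).2 hpn

theorem exists_dvd_add_mul_iff_modEq {n e : ℕ} (b : ℕ) (he : 0 < e) (h : e.Coprime n) :
    ∃ v : ℕ, ∀ m : ℕ, e ∣ b + n * m ↔ m ≡ v [MOD e] := by
  have hc : IsCoprime (e : ℤ) (n : ℤ) := Nat.isCoprime_iff_coprime.2 h
  obtain ⟨w, u, hwu⟩ := id hc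
  have he' : (e : ℤ) ≠ 0 := by exact_mod_cast he.ne'
  -- By Bézout `u` inverts `n` modulo `e`, so the class is that of `-b / n`.
  refine ⟨((-b * u) % e).toNat, fun m => ?_⟩
  rw [← Int.natCast_modEq_iff, Int.toNat_of_nonneg (Int.emod_nonneg _ he')]
  have h1 : (m : ℤ) ≡ (-b * u) % e [ZMOD e] ↔ (m : ℤ) ≡ -b * u [ZMOD e] := by
    simp [Int.ModEq]
  rw [h1, ← Int.natCast_dvd_natCast, Int.modEq_iff_dvd]
  have h2 : ((b + n * m : ℕ) : ℤ) = (e : ℤ) * (w * b) - n * (-b * u - m) := by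
    push_cast
    linear_combination (-(b : ℤ)) * hwu
  rw [h2, dvd_sub_right (dvd_mul_right _ _)]
  exact ⟨fun h => hc.dvd_of_dvd_mul_left h, fun h => h.mul_left _⟩

/-- As `d` is coprime to `n`, the condition on `m < N` is a single residue class modulo `d`, whose
count is `N / d` rounded up or down. -/
theorem abs_rem_progressionSieve_le_one {n : ℕ} (hn : 0 < n) (b N : ℕ) (z : ℝ) {d : ℕ}
    (hd : d ∣ (progressionSieve n b N z).prodPrimes) :
    |(progressionSieve n b N z).rem d| ≤ 1 := by
  have hd0 : 0 < d := Nat.pos_of_ne_zero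
    (ne_zero_of_dvd_ne_zero (progressionSieve n b N z).prodPrimes_ne_zero hd)
  obtain ⟨v, hv⟩ := exists_dvd_add_mul_iff_modEq b hd0
    (coprime_of_dvd_prodPrimes_progressionSieve hd)
  have h1 : (progressionSieve n b N z).multSum d = (N.count (· ≡ v [MOD d]) : ℝ) := by
    change ∑ x ∈ (range N).image (fun m => b + n * m), (if d ∣ x then (1 : ℝ) else 0) = _
    rw [sum_image (fun x _ y _ h => Nat.eq_of_mul_eq_mul_left hn (Nat.add_left_cancel h)),
      ← sum_filter, sum_const, nsmul_eq_mul, mul_one, Nat.count_eq_card_filter_range]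
    simp_rw [hv]
  rw [BoundingSieve.rem, h1, Nat.count_modEq_card _ hd0]
  change |_ - (d : ℝ)⁻¹ * (N : ℝ)| ≤ 1
  have hdR : (0 : ℝ) < d := by exact_mod_cast hd0
  have h2 : (N : ℝ) = d * (N / d : ℕ) + (N % d : ℕ) := by exact_mod_cast (Nat.div_add_mod N d).symm
  have h3 : (d : ℝ)⁻¹ * N = (N / d : ℕ) + ((N % d : ℕ) : ℝ) / d := by
    rw [inv_mul_eq_div, div_eq_iff hdR.ne', add_mul, div_mul_cancel₀ _ hdR.ne']
    linarith
  have h4 : ((N % d : ℕ) : ℝ) / d ≤ 1 := by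
    rw [div_le_one hdR]; exact_mod_cast (Nat.mod_lt _ hd0).le
  have h5 : 0 ≤ ((N % d : ℕ) : ℝ) / d := by positivity
  rw [h3, abs_le]
  push_cast
  split_ifs <;> constructor <;> linarith

/-- The product of the primes dividing `m` but not `n`. -/
noncomputable def coprimeRadical (n m : ℕ) : ℕ := ∏ p ∈ m.primeFactors with ¬ p ∣ n, p

theorem prime_dvd_coprimeRadical_iff {n m p : ℕ} (hp : p.Prime) :
    p ∣ coprimeRadical n m ↔ p ∈ m.primeFactors ∧ ¬ p ∣ n := by
  rw [coprimeRadical, prime_dvd_prod_primes_iff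
    (fun q hq => Nat.prime_of_mem_primeFactors (mem_filter.1 hq).1) hp, mem_filter]

theorem coprimeRadical_dvd (n m : ℕ) : coprimeRadical n m ∣ m :=
  (prod_dvd_prod_of_subset _ _ _ (filter_subset _ _)).trans (Nat.prod_primeFactors_dvd m)

/-- Group the terms of `∑ 1 / m ≥ log z` by `l = coprimeRadical n m`. Then `m / l` is composed of
primes dividing `l * n`, so by the Euler product the group contributes at most `g(l) * n / φ(n)`. -/
theorem log_le_mul_selbergSum {n : ℕ} (hn : 0 < n) (b N : ℕ) {z : ℝ} (hz : 1 ≤ z) :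
    Real.log z ≤ (n : ℝ) / n.totient * (progressionSieve n b N z).selbergSum z := by
  set s := progressionSieve n b N z with hs
  have hP0 := s.prodPrimes_ne_zero
  have hlog : Real.log z ≤ ∑ m ∈ Icc 1 ⌊z⌋₊, (m : ℝ)⁻¹ := by
    have := log_le_harmonic_floor z (by linarith)
    rwa [harmonic_eq_sum_Icc, Rat.cast_sum, sum_congr rfl fun m _ => by
      rw [Rat.cast_inv, Rat.cast_natCast]] at this
  refine hlog.trans ?_
  have hmaps : ∀ m ∈ Icc 1 ⌊z⌋₊, coprimeRadical n m ∈
      s.prodPrimes.divisors.filter (fun l : ℕ => (l : ℝ) ≤ z) := by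
    intro m hm
    rw [mem_Icc] at hm
    rw [mem_filter, Nat.mem_divisors]
    have hle : coprimeRadical n m ≤ ⌊z⌋₊ :=
      (Nat.le_of_dvd hm.1 (coprimeRadical_dvd n m)).trans hm.2
    refine ⟨⟨?_, hP0⟩, (Nat.le_floor_iff (by linarith)).1 hle⟩
    refine prod_dvd_prod_of_subset _ (siftingPrimes n z) (fun p => p) fun p hp => ?_
    rw [mem_filter, Nat.mem_primeFactors] at hp
    exact mem_siftingPrimes.2 ⟨(Nat.le_of_dvd hm.1 hp.1.2.1).trans hm.2, hp.1.1, hp.2⟩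
  rw [← sum_fiberwise_of_maps_to hmaps, BoundingSieve.selbergSum, mul_sum]
  refine sum_le_sum fun l hl => ?_
  rw [mem_filter, Nat.mem_divisors] at hl
  have hl0 : 0 < l := Nat.pos_of_ne_zero (ne_zero_of_dvd_ne_zero hP0 hl.1.1)
  have hcop : l.Coprime n := coprime_of_dvd_prodPrimes_progressionSieve hl.1.1
  set A := (Icc 1 ⌊z⌋₊).filter (fun m => coprimeRadical n m = l) with hA
  have hdvd : ∀ m ∈ A, l ∣ m := fun m hm => (mem_filter.1 hm).2 ▸ coprimeRadical_dvd n m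
  have hinj : Set.InjOn (fun m => m / l) (A : Set ℕ) := by
    intro m hm m' hm' h
    rw [← Nat.div_mul_cancel (hdvd m hm), ← Nat.div_mul_cancel (hdvd m' hm')]
    exact congrArg (· * l) h
  have h1 : ∑ m ∈ A, (m : ℝ)⁻¹ = (l : ℝ)⁻¹ * ∑ t ∈ A.image (fun m => m / l), (t : ℝ)⁻¹ := by
    rw [sum_image hinj, mul_sum]
    refine sum_congr rfl fun m hm => ?_
    rw [← mul_inv, ← Nat.cast_mul, Nat.mul_div_cancel' (hdvd m hm)]
  have h2 : ∑ t ∈ A.image (fun m => m / l), (t : ℝ)⁻¹ ≤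
      ∏ p ∈ l.primeFactors ∪ n.primeFactors, (1 - (p : ℝ)⁻¹)⁻¹ := by
    refine sum_inv_le_prod_of_mem_factoredNumbers _ _ (fun p hp => ?_) fun t ht => ?_
    · rcases mem_union.1 hp with h | h <;> exact Nat.prime_of_mem_primeFactors h
    · obtain ⟨m, hm, rfl⟩ := mem_image.1 ht
      have hm' := mem_filter.1 hm
      have hm0 : m ≠ 0 := by have := (mem_Icc.1 hm'.1).1; omega
      refine Nat.mem_factoredNumbers_of_dvd (m := m) ?_ (Nat.div_dvd_of_dvd (hdvd m hm))
      refine Nat.mem_factoredNumbers_of_primeFactors_subset hm0 fun p hp => ?_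
      have hpp := Nat.prime_of_mem_primeFactors hp
      by_cases hpn : p ∣ n
      · exact mem_union_right _ (Nat.mem_primeFactors.2 ⟨hpp, hpn, hn.ne'⟩)
      · refine mem_union_left _ (Nat.mem_primeFactors.2 ⟨hpp, ?_, hl0.ne'⟩)
        rw [← hm'.2]
        exact (prime_dvd_coprimeRadical_iff hpp).2 ⟨hp, hpn⟩
  have h3 : s.selbergTerms l = (l : ℝ)⁻¹ * ∏ p ∈ l.primeFactors, (1 - (p : ℝ)⁻¹)⁻¹ := by
    rw [s.selbergTerms_apply]; rfl
  rw [prod_union hcop.disjoint_primeFactors, prod_inv_one_sub_inv_primeFactors hn.ne'] at h2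
  rw [h1, h3]
  calc _ ≤ (l : ℝ)⁻¹ * ((∏ p ∈ l.primeFactors, (1 - (p : ℝ)⁻¹)⁻¹) * (n / n.totient)) := by
        gcongr
    _ = _ := by ring

/-- A form of the Brun–Titchmarsh inequality with a free sieving parameter `z`. -/
theorem primeCountAP_le {y : ℝ} (hy : 0 ≤ y) {n : ℕ} (hn : 0 < n) {a : ℤ}
    {z : ℝ} (hz : 1 < z) :
    (primeCountAP y n a : ℝ) ≤
      (n : ℝ) / n.totient * ((y / n + 1) / Real.log z) + z ^ 2 + z := by
  set b : ℕ := (a % n).toNat with hb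
  have hn' : (n : ℤ) ≠ 0 := by exact_mod_cast hn.ne'
  have hb' : (b : ℤ) = a % n := Int.toNat_of_nonneg (Int.emod_nonneg _ hn')
  set N : ℕ := ⌊y / n⌋₊ + 1 with hN
  set s := progressionSieve n b N z with hs
  have hnR : (0 : ℝ) < n := by exact_mod_cast hn
  have hlog : 0 < Real.log z := Real.log_pos hz
  have hsift : s.siftedSum =
      ((((range N).image (fun m => b + n * m)).filter (fun v => s.prodPrimes.Coprime v)).card
        : ℝ) := by
    change ∑ x ∈ (range N).image (fun m => b + n * m),
      (if s.prodPrimes.Coprime x then (1 : ℝ) else 0) = _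
    rw [← sum_filter, sum_const, nsmul_eq_mul, mul_one]
  -- Primes `p ≤ z` may be sifted out by themselves; they are counted trivially and cause the extra
  -- `+ z`.
  have hsub : (Iic ⌊y⌋₊).filter (fun p : ℕ => p.Prime ∧ (p : ℤ) ≡ a [ZMOD (n : ℤ)]) ⊆
      ((range N).image (fun m => b + n * m)).filter (fun v => s.prodPrimes.Coprime v) ∪
        Icc 1 ⌊z⌋₊ := by
    intro p hp
    rw [mem_filter, mem_Iic] at hp
    obtain ⟨hpy, hpp, hpa⟩ := hp
    rw [mem_union]
    by_cases hpz : p ≤ ⌊z⌋₊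
    · exact Or.inr (mem_Icc.2 ⟨hpp.one_le, hpz⟩)
    left
    rw [mem_filter]
    constructor
    · have h1 : p % n = b := by
        have : ((p % n : ℕ) : ℤ) = b := by rw [hb']; exact_mod_cast hpa
        exact_mod_cast this
      refine mem_image.2 ⟨p / n, mem_range.2 (Nat.lt_succ_of_le (Nat.le_floor ?_)), ?_⟩
      · have h2 : (p : ℝ) ≤ y := (Nat.le_floor_iff hy).1 hpy
        exact Nat.cast_div_le.trans (by gcongr)
      · rw [← h1, Nat.mod_add_div]
    · refine Nat.Coprime.symm ((Nat.Prime.coprime_iff_not_dvd hpp).2 fun h => ?_)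
      exact hpz ((prime_dvd_prodPrimes_progressionSieve hpp).1 h).1
  have hcard : (primeCountAP y n a : ℝ) ≤ s.siftedSum + z := by
    rw [hsift]
    have h1 := (card_le_card hsub).trans (card_union_le _ _)
    have h2 : ((Icc 1 ⌊z⌋₊).card : ℝ) ≤ z := by
      simpa using Nat.floor_le (by linarith : (0 : ℝ) ≤ z)
    have h3 := (Nat.cast_le (α := ℝ)).2 h1
    rw [Nat.cast_add] at h3
    exact h3.trans (by gcongr)
  have hsel := s.siftedSum_le_div_selbergSum_add_sq hz.le
    (fun d hd => abs_rem_progressionSieve_le_one hn b N z hd)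
  have hS : 0 < s.selbergSum z := by linarith [s.one_le_selbergSum hz.le]
  have hmass : s.totalMass ≤ y / n + 1 := by
    change (N : ℝ) ≤ _
    rw [hN]; push_cast
    gcongr
    exact Nat.floor_le (by positivity)
  have hlb := log_le_mul_selbergSum hn b N hz.le
  have hmain : s.totalMass / s.selbergSum z ≤
      (n : ℝ) / n.totient * ((y / n + 1) / Real.log z) := by
    rw [← mul_div_assoc, div_le_div_iff₀ hS hlog]
    calc s.totalMass * Real.log z ≤ (y / n + 1) *
          ((n : ℝ) / n.totient * s.selbergSum z) := by gcongr
      _ = _ := by ring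
  linarith

theorem natCast_div_totient_one_le {n : ℕ} (hn : 0 < n) : (1 : ℝ) ≤ (n : ℝ) / n.totient := by
  rw [one_le_div (by exact_mod_cast Nat.totient_pos.2 hn)]
  exact_mod_cast Nat.totient_le n

/-- Brun–Titchmarsh with the constant `2.6`. -/
theorem exists_forall_primeCountAP_le :
    ∃ M₀ : ℝ, 1 < M₀ ∧ ∀ M : ℝ, M₀ ≤ M → ∀ (n : ℕ) (a : ℤ), 0 < n →
      (primeCountAP (M * n) n a : ℝ) ≤ (n : ℝ) / n.totient * (2.6 * M / Real.log M) := by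
  have h1 : ∀ᶠ M : ℝ in atTop, ‖Real.log M‖ ≤ 0.02 * ‖M ^ (0.2 : ℝ)‖ :=
    (isLittleO_log_rpow_atTop (by norm_num : (0 : ℝ) < 0.2)).bound (by norm_num)
  obtain ⟨M₁, hM₁⟩ := eventually_atTop.1 h1
  refine ⟨max M₁ 1000, lt_of_lt_of_le (by norm_num) (le_max_right _ _), fun M hM n a hn => ?_⟩
  have hM1 := hM₁ M ((le_max_left _ _).trans hM)
  have hM2 : (1000 : ℝ) ≤ M := (le_max_right _ _).trans hM
  have hM0 : 0 < M := by linarith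
  have hlog : 0 < Real.log M := Real.log_pos (by linarith)
  rw [Real.norm_of_nonneg hlog.le, Real.norm_of_nonneg (by positivity)] at hM1
  have hnR : (0 : ℝ) < n := by exact_mod_cast hn
  -- The main term becomes `2.5 * M / log M`, while the error `z ^ 2 = M ^ 0.8` still saves a power
  -- of `M`.
  have hz : 1 < M ^ (0.4 : ℝ) := Real.one_lt_rpow (by linarith) (by norm_num)
  have h := primeCountAP_le (y := M * n) (by positivity) hn (a := a) hz
  rw [mul_div_cancel_right₀ _ hnR.ne', Real.log_rpow hM0] at h
  have hsq : (M ^ (0.4 : ℝ)) ^ 2 = M ^ (0.8 : ℝ) := by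
    rw [← Real.rpow_natCast, ← Real.rpow_mul hM0.le]; norm_num
  have hle : M ^ (0.4 : ℝ) ≤ M ^ (0.8 : ℝ) :=
    Real.rpow_le_rpow_of_exponent_le (by linarith) (by norm_num)
  have hmul : M ^ (0.8 : ℝ) * M ^ (0.2 : ℝ) = M := by
    rw [← Real.rpow_add hM0]; norm_num
  have herr : M ^ (0.8 : ℝ) * Real.log M ≤ 0.02 * M := by
    calc _ ≤ M ^ (0.8 : ℝ) * (0.02 * M ^ (0.2 : ℝ)) := by gcongr
      _ = 0.02 * M := by rw [mul_left_comm, hmul]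
  have hone := natCast_div_totient_one_le hn
  have herr2 : (M ^ (0.4 : ℝ)) ^ 2 + M ^ (0.4 : ℝ) ≤ 0.04 * M / Real.log M := by
    rw [le_div_iff₀ hlog, hsq]
    nlinarith
  have hmain : (M + 1) / (0.4 * Real.log M) ≤ 2.51 * M / Real.log M := by
    rw [div_le_div_iff₀ (by positivity) hlog]
    nlinarith
  calc (primeCountAP (M * n) n a : ℝ)
      ≤ (n : ℝ) / n.totient * (2.51 * M / Real.log M) + 1 * (0.04 * M / Real.log M) := by
        refine h.trans ?_
        rw [add_assoc, one_mul]
        gcongr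
    _ ≤ (n : ℝ) / n.totient * (2.51 * M / Real.log M) +
        (n : ℝ) / n.totient * (0.04 * M / Real.log M) := by gcongr
    _ = (n : ℝ) / n.totient * (2.55 * M / Real.log M) := by ring
    _ ≤ _ := by gcongr; norm_num

/-- Chebyshev's lower bound with the constant `0.68`. -/
theorem exists_forall_le_primeCounting :
    ∃ y₀ : ℝ, 1 < y₀ ∧ ∀ y : ℝ, y₀ ≤ y →
      0.68 * y / Real.log y ≤ (Nat.primeCounting ⌊y⌋₊ : ℝ) := by
  have h1 : ∀ᶠ y : ℝ in atTop, ‖Real.log y‖ ≤ 0.005 * ‖y‖ :=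
    Real.isLittleO_log_id_atTop.bound (by norm_num)
  obtain ⟨y₁, hy₁⟩ := eventually_atTop.1 h1
  refine ⟨max y₁ 1000, lt_of_lt_of_le (by norm_num) (le_max_right _ _), fun y hy => ?_⟩
  have hy1 := hy₁ y ((le_max_left _ _).trans hy)
  have hy2 : (1000 : ℝ) ≤ y := (le_max_right _ _).trans hy
  have hlog : 0 < Real.log y := Real.log_pos (by linarith)
  rw [Real.norm_of_nonneg hlog.le, Real.norm_of_nonneg (by linarith)] at hy1
  refine le_trans ?_ (Chebyshev.pi_ge' (by linarith : 1 < y))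
  gcongr
  have h2 : Real.log (y + 2) ≤ Real.log 2 + Real.log y := by
    rw [← Real.log_mul (by norm_num) (by linarith)]
    exact Real.log_le_log (by linarith) (by linarith)
  nlinarith [Real.log_two_gt_d9, Real.log_two_lt_d9]

/-! ### Divisors of `L` and their multipliers -/

/-- Discarding the divisors of a squarefree number that are divisible by some prime of `R`
shrinks the set of divisors up to `X` by a factor of at most `2 ^ #R`. -/
theorem card_divisors_le_two_pow_mul {L : ℕ} (hL : Squarefree L) (R : Finset ℕ)
    (hR : ∀ p ∈ R, p.Prime) (X : ℝ) :
    (L.divisors.filter (fun d : ℕ => (d : ℝ) ≤ X)).card ≤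
      2 ^ R.card * (L.divisors.filter (fun d : ℕ => (d : ℝ) ≤ X ∧ ∀ p ∈ R, ¬ p ∣ d)).card := by
  rw [← card_powerset, ← card_product]
  -- A squarefree `d` is recovered from its primes in `R` and its part free of `R`, which still
  -- divides `L` and is at most `d`.
  refine card_le_card_of_injOn (fun d => (d.primeFactors ∩ R, ∏ p ∈ d.primeFactors \ R, p)) ?_ ?_
  · intro d hd
    simp only [coe_filter, Set.mem_ofPred_eq, Nat.mem_divisors] at hd
    have hdvd : ∏ p ∈ d.primeFactors \ R, p ∣ d :=
      (prod_dvd_prod_of_subset _ _ _ sdiff_subset).trans (Nat.prod_primeFactors_dvd d)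
    simp only [coe_product, coe_filter, Set.mem_prod, mem_coe, mem_powerset, Set.mem_ofPred_eq,
      Nat.mem_divisors]
    refine ⟨inter_subset_right, ⟨hdvd.trans hd.1.1, hd.1.2⟩, le_trans ?_ hd.2, fun p hp h => ?_⟩
    · exact_mod_cast Nat.le_of_dvd
        (Nat.pos_of_ne_zero (ne_zero_of_dvd_ne_zero hd.1.2 hd.1.1)) hdvd
    · rw [prime_dvd_prod_primes_iff (fun q hq => Nat.prime_of_mem_primeFactors
        (mem_sdiff.1 hq).1) (hR p hp)] at h
      exact (mem_sdiff.1 h).2 hp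
  · intro d hd e he h
    simp only [coe_filter, Set.mem_ofPred_eq, Nat.mem_divisors] at hd he
    have key : ∀ {c : ℕ}, c ∣ L →
        (∏ p ∈ c.primeFactors ∩ R, p) * ∏ p ∈ c.primeFactors \ R, p = c := fun {c} hc => by
      rw [prod_inter_mul_prod_sdiff, Nat.prod_primeFactors_of_squarefree
        (hL.squarefree_of_dvd hc)]
    simp only [Prod.mk.injEq] at h
    rw [← key hd.1.1, ← key he.1.1, h.1, h.2]

/-- Given a modulus `d` in which the primes `≡ a` have at least half of the expected density up to
`d * X`, many of these primes `p` exceed `|a|` and have `(p - a) / d` free of prime factors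
of `L`. -/
theorem le_card_primes_quotient_coprime {M₀ : ℝ} {a : ℤ}
    (hBT : ∀ M : ℝ, M₀ ≤ M → ∀ n : ℕ, 0 < n →
      (primeCountAP (M * n) n a : ℝ) ≤ (n : ℝ) / n.totient * (2.6 * M / Real.log M))
    {β x X : ℝ} (hβ0 : 0 < β) (hβ1 : β < 1) (hx : 1 < x) (hX : X = x ^ β)
    (hM₀x : M₀ ≤ x ^ (β / 2)) (haX : |(a : ℝ)| * Real.log x ≤ 0.01 * X)
    {L d : ℕ} (hL : ∀ q ∈ L.primeFactors, (q : ℝ) ≤ x ^ (β / 2))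
    (hsum : ∑ q ∈ L.primeFactors, (1 : ℝ) / q ≤ β / 32) (hd : 0 < d)
    (hlow : 0.34 * (d * X) / (d.totient * Real.log x) ≤ primeCountAP (d * X) d a) :
    0.16 * X / Real.log x ≤
      (((Iic ⌊d * X⌋₊).filter (fun p : ℕ => (p.Prime ∧ (p : ℤ) ≡ a [ZMOD (d : ℤ)]) ∧
        a.natAbs < p ∧ ∀ q ∈ L.primeFactors, ¬ (p : ℤ) ≡ a [ZMOD ((d * q : ℕ) : ℤ)])).card : ℝ) := by
  have hx0 : 0 < x := by linarith
  have hlog : 0 < Real.log x := Real.log_pos hx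
  have hX0 : 0 < X := hX ▸ Real.rpow_pos_of_pos hx0 _
  have hdR : (0 : ℝ) < d := by exact_mod_cast hd
  have hφ : (0 : ℝ) < d.totient := by exact_mod_cast Nat.totient_pos.2 hd
  set W : ℝ := d * X / (d.totient * Real.log x) with hW
  have hW0 : 0 < W := by positivity
  have hWX : X / Real.log x ≤ W := by
    have := natCast_div_totient_one_le hd
    calc X / Real.log x = 1 * (X / Real.log x) := (one_mul _).symm
      _ ≤ (d : ℝ) / d.totient * (X / Real.log x) := by gcongr
      _ = W := by rw [hW]; field_simp
  set good := (Iic ⌊d * X⌋₊).filter (fun p : ℕ => (p.Prime ∧ (p : ℤ) ≡ a [ZMOD (d : ℤ)]) ∧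
    a.natAbs < p ∧ ∀ q ∈ L.primeFactors, ¬ (p : ℤ) ≡ a [ZMOD ((d * q : ℕ) : ℤ)]) with hgood
  have hsub : (Iic ⌊d * X⌋₊).filter (fun p : ℕ => p.Prime ∧ (p : ℤ) ≡ a [ZMOD (d : ℤ)]) ⊆
      (good ∪ Icc 1 a.natAbs) ∪ L.primeFactors.biUnion (fun q => (Iic ⌊d * X⌋₊).filter
        (fun p : ℕ => p.Prime ∧ (p : ℤ) ≡ a [ZMOD ((d * q : ℕ) : ℤ)])) := by
    intro p hp
    rw [mem_filter] at hp
    simp only [mem_union, mem_biUnion, hgood, mem_filter, mem_Icc]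
    by_cases h1 : p ≤ a.natAbs
    · exact Or.inl (Or.inr ⟨hp.2.1.one_le, h1⟩)
    by_cases h2 : ∀ q ∈ L.primeFactors, ¬ (p : ℤ) ≡ a [ZMOD ((d * q : ℕ) : ℤ)]
    · exact Or.inl (Or.inl ⟨hp.1, hp.2, not_le.1 h1, h2⟩)
    · push Not at h2
      obtain ⟨q, hq, h3⟩ := h2
      exact Or.inr ⟨q, hq, hp.1, hp.2.1, h3⟩
  have hcard : (primeCountAP (d * X) d a : ℝ) ≤ good.card + |(a : ℝ)| +
      ∑ q ∈ L.primeFactors, (primeCountAP (d * X) (d * q) a : ℝ) := by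
    have h1 := (card_le_card hsub).trans ((card_union_le _ _).trans
      (add_le_add (card_union_le _ _) card_biUnion_le))
    have h2 := (Nat.cast_le (α := ℝ)).2 h1
    rw [Nat.card_Icc, add_tsub_cancel_right] at h2
    push_cast [Nat.cast_natAbs] at h2
    exact_mod_cast h2
  have hq : ∀ q ∈ L.primeFactors, (primeCountAP (d * X) (d * q) a : ℝ) ≤
      W * (5.2 * (33 / 32) / β) * (1 / q) := by
    intro q hqL
    have hqp := Nat.prime_of_mem_primeFactors hqL
    have hq0 : (0 : ℝ) < q := by exact_mod_cast hqp.pos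
    -- A single term of the sum already obeys `1 / q ≤ β / 32 < 1 / 32`; hence `q ≥ 33` and `φ(q) ≥
    -- (32 / 33) * q`.
    have h32 : (32 : ℝ) < q := by
      have h1 : (1 : ℝ) / q ≤ β / 32 :=
        (single_le_sum (f := fun q : ℕ => (1 : ℝ) / q) (fun _ _ => by positivity) hqL).trans hsum
      rw [div_le_div_iff₀ hq0 (by norm_num)] at h1
      nlinarith
    have h33 : (33 : ℝ) ≤ q := by
      have : 32 < q := by exact_mod_cast h32
      exact_mod_cast this
    -- The smoothness of `L` enters here: it keeps `log (X / q)` at least `(β / 2) * log x`, which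
    -- doubles `2.6` to `5.2`.
    have hMq : x ^ (β / 2) ≤ X / q := by
      rw [le_div_iff₀ hq0, hX]
      calc x ^ (β / 2) * q ≤ x ^ (β / 2) * x ^ (β / 2) := by gcongr; exact hL q hqL
        _ = x ^ β := by rw [← Real.rpow_add hx0]; ring_nf
    have hM := hBT (X / q) (hM₀x.trans hMq) (d * q) (Nat.mul_pos hd hqp.pos)
    have hy : X / q * ((d * q : ℕ) : ℝ) = d * X := by push_cast; field_simp
    rw [hy] at hM
    refine hM.trans ?_
    have hlogM : β / 2 * Real.log x ≤ Real.log (X / q) := by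
      rw [← Real.log_rpow hx0]
      exact Real.log_le_log (Real.rpow_pos_of_pos hx0 _) hMq
    have hlogM0 : 0 < Real.log (X / q) := lt_of_lt_of_le (by positivity) hlogM
    -- Here `q` may divide `d`, so only supermultiplicativity of the totient is available.
    have hφq : (d.totient : ℝ) * (32 / 33 * q) ≤ (d * q).totient := by
      have h1 : (d.totient : ℝ) * q.totient ≤ (d * q).totient := by
        exact_mod_cast Nat.totient_super_multiplicative d q
      have h2 : (q.totient : ℝ) = q - 1 := by
        rw [Nat.totient_prime hqp, Nat.cast_sub hqp.one_le, Nat.cast_one]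
      refine le_trans ?_ h1
      gcongr
      rw [h2]; linarith
    calc ((d * q : ℕ) : ℝ) / (d * q).totient * (2.6 * (X / q) / Real.log (X / q))
        ≤ ((d * q : ℕ) : ℝ) / (d.totient * (32 / 33 * q)) *
          (2.6 * (X / q) / (β / 2 * Real.log x)) := by gcongr
      _ = W * (5.2 * (33 / 32) / β) * (1 / q) := by
          rw [hW]; push_cast; field_simp; norm_num
  have hqsum : ∑ q ∈ L.primeFactors, (primeCountAP (d * X) (d * q) a : ℝ) ≤ 0.17 * W := by
    refine (sum_le_sum hq).trans ?_
    rw [← mul_sum]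
    calc W * (5.2 * (33 / 32) / β) * ∑ q ∈ L.primeFactors, (1 : ℝ) / q
        ≤ W * (5.2 * (33 / 32) / β) * (β / 32) := by gcongr
      _ = 5.2 * (33 / 1024) * W := by field_simp; norm_num
      _ ≤ 0.17 * W := by gcongr; norm_num
  have ha : |(a : ℝ)| ≤ 0.01 * (X / Real.log x) := by
    rw [← mul_div_assoc, le_div_iff₀ hlog]; exact haX
  have hlow' : 0.34 * W ≤ primeCountAP (d * X) d a := by
    rw [hW, ← mul_div_assoc]; exact hlow
  rw [mul_div_assoc]
  linarith

/-- A pigeonhole principle: if every `d ∈ G` is related to at least `c` elements of `K`, then some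
`k ∈ K` is related to at least `c * #G / #K` elements of `G`. -/
theorem exists_mul_card_le_card_mul_card_filter {ι κ : Type*} {G : Finset ι} {K : Finset κ}
    (r : ι → κ → Prop) [∀ i k, Decidable (r i k)] {c : ℝ} (hc : 0 < c) (hG : G.Nonempty)
    (h : ∀ d ∈ G, c ≤ ((K.filter (fun k => r d k)).card : ℝ)) :
    ∃ k ∈ K, c * G.card ≤ K.card * ((G.filter (fun d => r d k)).card : ℝ) := by
  have hK : K.Nonempty := by
    obtain ⟨d, hd⟩ := hG
    have h1 : 0 < (K.filter (fun k => r d k)).card := by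
      exact_mod_cast hc.trans_le (h d hd)
    exact (card_pos.1 h1).mono (filter_subset _ _)
  have hK0 : (0 : ℝ) < K.card := by exact_mod_cast hK.card_pos
  have hsum : c * G.card ≤ ∑ k ∈ K, ((G.filter (fun d => r d k)).card : ℝ) := by
    calc c * G.card = ∑ d ∈ G, c := by rw [sum_const, nsmul_eq_mul, mul_comm]
      _ ≤ ∑ d ∈ G, ((K.filter (fun k => r d k)).card : ℝ) := sum_le_sum h
      _ = ∑ k ∈ K, ((G.filter (fun d => r d k)).card : ℝ) := by
          exact_mod_cast sum_card_bipartiteAbove_eq_sum_card_bipartiteBelow r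
  obtain ⟨k, hk, hle⟩ := exists_le_of_sum_le (s := K) (f := fun _ => c * G.card / K.card)
    (g := fun k => ((G.filter (fun d => r d k)).card : ℝ)) hK (by
      rw [sum_const, nsmul_eq_mul, mul_div_cancel₀ _ hK0.ne']; exact hsum)
  refine ⟨k, hk, ?_⟩
  rw [div_le_iff₀ hK0] at hle
  linarith

/-- The primes `p ≡ a` modulo `d` with `|a| < p ≤ d * X` and no prime factor of `L` in `(p - a) / d`
give multipliers `k ≤ X + |a|` coprime to `a * L`. -/
theorem card_primes_le_card_multipliers {a : ℤ} (ha : a ≠ 0) {x X : ℝ} (hX : 0 ≤ X) {L d : ℕ} (hL0 : L ≠ 0)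
    (hd : 0 < d) (hdx : d * X ≤ x) (r : ℕ → Prop) [DecidablePred r]
    (hr : ∀ k, r k ↔ ∃ p : ℕ, p.Prime ∧ (p : ℤ) = (d : ℤ) * (k : ℤ) + a ∧ (p : ℝ) ≤ x)
    (c : ℕ → Prop) [DecidablePred c] (hc : ∀ k : ℕ, c k ↔ IsCoprime (k : ℤ) (a * (L : ℤ))) :
    ((Iic ⌊d * X⌋₊).filter (fun p : ℕ => (p.Prime ∧ (p : ℤ) ≡ a [ZMOD (d : ℤ)]) ∧
        a.natAbs < p ∧ ∀ q ∈ L.primeFactors, ¬ (p : ℤ) ≡ a [ZMOD ((d * q : ℕ) : ℤ)])).card ≤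
      (((Icc 1 ⌊X + |(a : ℝ)|⌋₊).filter c).filter r).card := by
  have hdR : (1 : ℝ) ≤ d := by exact_mod_cast hd
  have hdZ : (0 : ℤ) < d := by exact_mod_cast hd
  have key : ∀ p : ℕ, (p : ℤ) ≡ a [ZMOD (d : ℤ)] → a.natAbs < p →
      ∃ k : ℕ, 0 < k ∧ (p : ℤ) = d * k + a := by
    intro p hpa hap
    obtain ⟨k, hk⟩ := hpa.symm.dvd
    have hpos : 0 < (d : ℤ) * k := by omega
    have hk0 : 0 < k := pos_of_mul_pos_right hpos hdZ.le
    refine ⟨k.toNat, by omega, ?_⟩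
    rw [Int.toNat_of_nonneg hk0.le]
    linarith
  refine card_le_card_of_injOn (fun p => (((p : ℤ) - a) / d).toNat) ?_ ?_
  · intro p hp
    simp only [coe_filter, Set.mem_ofPred_eq, mem_Iic] at hp
    obtain ⟨hpX, ⟨hpp, hpa⟩, hap, hq⟩ := hp
    obtain ⟨k, hk0, hk⟩ := key p hpa hap
    have hpX' : (p : ℝ) ≤ d * X := (Nat.le_floor_iff (by positivity)).1 hpX
    have hval : (((p : ℤ) - a) / d).toNat = k := by
      rw [hk, add_sub_cancel_right, Int.mul_ediv_cancel_left _ hdZ.ne', Int.toNat_natCast]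
    simp only [coe_filter, Set.mem_ofPred_eq, mem_filter, mem_Icc, hval, hr, hc]
    refine ⟨⟨⟨hk0, Nat.le_floor ?_⟩, ?_⟩, p, hpp, hk, hpX'.trans hdx⟩
    · have hkR : (p : ℝ) = d * k + a := by exact_mod_cast hk
      have h1 : (d : ℝ) * k ≤ d * (X + |(a : ℝ)|) := by
        nlinarith [neg_abs_le (a : ℝ), abs_nonneg (a : ℝ)]
      exact le_of_mul_le_mul_left h1 (by linarith)
    · refine IsCoprime.mul_right ?_ ?_
      · rw [Int.isCoprime_iff_nat_coprime, Int.natAbs_natCast]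
        refine Nat.coprime_of_dvd fun q hqp hqk hqa => ?_
        have h1 : (q : ℤ) ∣ p := by
          rw [hk]
          exact dvd_add ((Int.natCast_dvd_natCast.2 hqk).mul_left _) (Int.natCast_dvd.2 hqa)
        have h2 : q = p := (Nat.prime_dvd_prime_iff_eq hqp hpp).1 (Int.natCast_dvd_natCast.1 h1)
        have := Nat.le_of_dvd (Int.natAbs_pos.2 ha) hqa
        omega
      · rw [Nat.isCoprime_iff_coprime]
        refine Nat.coprime_of_dvd fun q hqp hqk hqL => ?_
        refine hq q (Nat.mem_primeFactors.2 ⟨hqp, hqL, hL0⟩) (Int.ModEq.symm ?_)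
        rw [Int.modEq_iff_dvd, hk, add_sub_cancel_right]
        push_cast
        exact mul_dvd_mul_left _ (Int.natCast_dvd_natCast.2 hqk)
  · intro p hp p' hp' h
    simp only [coe_filter, Set.mem_ofPred_eq, mem_Iic] at hp hp'
    obtain ⟨k, hk0, hk⟩ := key p hp.2.1.2 hp.2.2.1
    obtain ⟨k', hk0', hk'⟩ := key p' hp'.2.1.2 hp'.2.2.1
    simp only [hk, hk', add_sub_cancel_right, Int.mul_ediv_cancel_left _ hdZ.ne',
      Int.toNat_natCast] at h
    have : (p : ℤ) = p' := by rw [hk, hk', h]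
    exact_mod_cast this

theorem theorem3p1 (B : ℝ) (hB : B ∈ admissibleExponents)
    (D : ℕ) (hD : IsExceptionalBound B D) (a : ℤ) (ha : a ≠ 0) :
    ∃ x₃ : ℝ, ∀ x : ℝ, x₃ ≤ x → ∀ L : ℕ, Squarefree L →
      (∀ q : ℕ, q.Prime → q ∣ L → (q : ℝ) ≤ x ^ ((1 - B) / 2)) →
      (∑ q ∈ L.primeFactors, (1 : ℝ) / (q : ℝ)) ≤ (1 - B) / 32 →
      ∃ k : ℕ, 0 < k ∧ (k : ℝ) ≤ x ^ (1 - B) + |(a : ℝ)| ∧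
        IsCoprime (k : ℤ) (a * (L : ℤ)) ∧
        (2 : ℝ) ^ (-(D : ℤ) - (ArithmeticFunction.cardDistinctFactors a.natAbs : ℤ) - 3)
              / Real.log x
            * (Set.ncard {d : ℕ | d ∣ L ∧ 1 ≤ d ∧ (d : ℝ) ≤ x ^ B} : ℝ)
          ≤ (Set.ncard {d : ℕ | d ∣ L ∧
              ∃ p : ℕ, p.Prime ∧ (p : ℤ) = (d : ℤ) * (k : ℤ) + a ∧ (p : ℝ) ≤ x} : ℝ) := by
  classical
  obtain ⟨hB0, hB1, -⟩ := hB
  obtain ⟨-, x₂, hx₂⟩ := hD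
  obtain ⟨M₀, -, hBT⟩ := exists_forall_primeCountAP_le
  obtain ⟨y₀, hy₀, hπ⟩ := exists_forall_le_primeCounting
  have hβ0 : 0 < 1 - B := by linarith
  have ev1 : ∀ᶠ x : ℝ in atTop, M₀ ≤ x ^ ((1 - B) / 2) :=
    (tendsto_rpow_atTop (by linarith)).eventually_ge_atTop M₀
  have ev2 : ∀ᶠ x : ℝ in atTop, y₀ ≤ x ^ (1 - B) :=
    (tendsto_rpow_atTop hβ0).eventually_ge_atTop y₀
  have haR : (0 : ℝ) < |(a : ℝ)| := abs_pos.2 (by exact_mod_cast ha)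
  have ev3 : ∀ᶠ x : ℝ in atTop, ‖Real.log x‖ ≤ (0.01 / |(a : ℝ)|) * ‖x ^ (1 - B)‖ :=
    (isLittleO_log_rpow_atTop hβ0).bound (by positivity)
  have ev4 : ∀ᶠ x : ℝ in atTop, 1 ≤ Real.log x := Real.tendsto_log_atTop.eventually_ge_atTop 1
  obtain ⟨x₃, hx₃⟩ := eventually_atTop.1
    (ev1.and (ev2.and (ev3.and (ev4.and ((eventually_ge_atTop x₂).and (eventually_gt_atTop 1))))))
  refine ⟨x₃, fun x hx L hL hLq hLsum => ?_⟩
  obtain ⟨hM₀x, hy₀x, hloga, hlog1, hxx₂, hx1⟩ := hx₃ x hx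
  obtain ⟨𝒟, h𝒟card, h𝒟log, h𝒟⟩ := hx₂ x hxx₂
  have hx0 : 0 < x := by linarith
  have hlog : 0 < Real.log x := by linarith
  set X : ℝ := x ^ (1 - B) with hX
  have hX0 : 0 < X := Real.rpow_pos_of_pos hx0 _
  have haX : |(a : ℝ)| * Real.log x ≤ 0.01 * X := by
    rw [Real.norm_of_nonneg hlog.le, Real.norm_of_nonneg hX0.le] at hloga
    calc _ ≤ |(a : ℝ)| * (0.01 / |(a : ℝ)| * X) := by gcongr
      _ = 0.01 * X := by field_simp
  have hprime𝒟 : ∀ m ∈ 𝒟, m ≠ 1 := fun m hm h => by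
    have := h𝒟log m hm
    rw [h, Nat.cast_one] at this
    linarith
  set R : Finset ℕ := 𝒟.image Nat.minFac ∪ a.natAbs.primeFactors with hR
  have hRp : ∀ p ∈ R, p.Prime := by
    intro p hp
    rcases mem_union.1 hp with h | h
    · obtain ⟨m, hm, rfl⟩ := mem_image.1 h
      exact Nat.minFac_prime (hprime𝒟 m hm)
    · exact Nat.prime_of_mem_primeFactors h
  have hRcard : R.card ≤ D + ArithmeticFunction.cardDistinctFactors a.natAbs :=
    (card_union_le _ _).trans (add_le_add (card_image_le.trans h𝒟card) le_rfl)
  set G := L.divisors.filter (fun d : ℕ => (d : ℝ) ≤ x ^ B ∧ ∀ p ∈ R, ¬ p ∣ d) with hG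
  let r : ℕ → ℕ → Prop := fun d k =>
    ∃ p : ℕ, p.Prime ∧ (p : ℤ) = (d : ℤ) * (k : ℤ) + a ∧ (p : ℝ) ≤ x
  let K : Finset ℕ := (Icc 1 ⌊X + |(a : ℝ)|⌋₊).filter
    (fun k : ℕ => IsCoprime (k : ℤ) (a * (L : ℤ)))
  have hc : 0 < 0.16 * X / Real.log x := by positivity
  have hGne : G.Nonempty := by
    refine ⟨1, mem_filter.2 ⟨Nat.one_mem_divisors.2 hL.ne_zero, ?_, fun p hp h => ?_⟩⟩
    · exact_mod_cast Real.one_le_rpow hx1.le hB0.le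
    · exact (hRp p hp).one_lt.ne' (Nat.dvd_one.1 h)
  obtain ⟨k, hkK, hk⟩ := exists_mul_card_le_card_mul_card_filter (G := G) (K := K) r hc hGne (by
    intro d hd
    obtain ⟨hdL, hdB, hdR⟩ := mem_filter.1 hd
    have hd0 : 0 < d := Nat.pos_of_mem_divisors hdL
    have hdR0 : (1 : ℝ) ≤ d := by exact_mod_cast hd0
    have hφ : (0 : ℝ) < d.totient := by exact_mod_cast Nat.totient_pos.2 hd0
    have hdx : d * X ≤ x := by
      calc d * X ≤ x ^ B * x ^ (1 - B) := by gcongr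
        _ = x := by rw [← Real.rpow_add hx0]; simp
    have hcop : IsCoprime a (d : ℤ) := by
      rw [Int.isCoprime_iff_nat_coprime, Int.natAbs_natCast]
      refine Nat.coprime_of_dvd fun q hq hqa hqd => hdR q ?_ hqd
      exact mem_union_right _ (Nat.mem_primeFactors.2 ⟨hq, hqa, Int.natAbs_ne_zero.2 ha⟩)
    have hap := h𝒟 (d * X) a d hcop hd0
      (by rw [mul_div_cancel_right₀ _ hX0.ne']; exact le_min hdB le_rfl)
      (fun m hm h => hdR m.minFac (mem_union_left _ (mem_image_of_mem _ hm))
        ((Nat.minFac_dvd m).trans h))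
    have hy : y₀ ≤ d * X := hy₀x.trans (le_mul_of_one_le_left hX0.le hdR0)
    have hlogy : 0 < Real.log (d * X) := Real.log_pos (by linarith)
    have hlow : 0.34 * (d * X) / (d.totient * Real.log x) ≤ primeCountAP (d * X) d a := by
      refine le_trans ?_ hap
      calc 0.34 * (d * X) / (d.totient * Real.log x)
          = 0.68 * (d * X) / Real.log x / (2 * d.totient) := by field_simp; norm_num
        _ ≤ 0.68 * (d * X) / Real.log (d * X) / (2 * d.totient) := by
            gcongr
        _ ≤ _ := by gcongr; exact hπ _ hy
    refine (le_card_primes_quotient_coprime (fun M hM n hn => hBT M hM n a hn) hβ0 (by linarith)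
      hx1 hX hM₀x haX (fun q hq => hLq q (Nat.prime_of_mem_primeFactors hq)
        (Nat.dvd_of_mem_primeFactors hq)) hLsum hd0 hlow).trans ?_
    exact Nat.cast_le.2 (card_primes_le_card_multipliers ha hX0.le hL.ne_zero hd0 hdx (r d)
      (fun _ => Iff.rfl) (fun k : ℕ => IsCoprime (k : ℤ) (a * (L : ℤ))) (fun _ => Iff.rfl)))
  obtain ⟨hkI, hkc⟩ := mem_filter.1 hkK
  rw [mem_Icc] at hkI
  refine ⟨k, hkI.1, (Nat.le_floor_iff (by positivity)).1 hkI.2, hkc, ?_⟩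
  have hset1 : {d : ℕ | d ∣ L ∧ 1 ≤ d ∧ (d : ℝ) ≤ x ^ B} =
      (L.divisors.filter (fun d : ℕ => (d : ℝ) ≤ x ^ B) : Finset ℕ) := by
    ext d
    simp only [Set.mem_ofPred_eq, coe_filter, Nat.mem_divisors]
    exact ⟨fun h => ⟨⟨h.1, hL.ne_zero⟩, h.2.2⟩, fun h => ⟨h.1.1,
      Nat.pos_of_dvd_of_pos h.1.1 (Nat.pos_of_ne_zero hL.ne_zero), h.2⟩⟩
  have hset2 : {d : ℕ | d ∣ L ∧ ∃ p : ℕ, p.Prime ∧ (p : ℤ) = (d : ℤ) * (k : ℤ) + a ∧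
      (p : ℝ) ≤ x} = (L.divisors.filter (fun d => r d k) : Finset ℕ) := by
    ext d
    simp only [Set.mem_ofPred_eq, coe_filter, Nat.mem_divisors]
    exact ⟨fun h => ⟨⟨h.1, hL.ne_zero⟩, h.2⟩, fun h => ⟨h.1.1, h.2⟩⟩
  rw [hset1, hset2, Set.ncard_coe_finset, Set.ncard_coe_finset]
  set w := ArithmeticFunction.cardDistinctFactors a.natAbs with hw
  have hall : ((L.divisors.filter (fun d : ℕ => (d : ℝ) ≤ x ^ B)).card : ℝ) ≤
      2 ^ (D + w) * (G.card : ℝ) := by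
    have h1 := card_divisors_le_two_pow_mul hL R hRp (x ^ B)
    have h2 := h1.trans (Nat.mul_le_mul_right _ (Nat.pow_le_pow_right two_pos hRcard))
    exact_mod_cast h2
  have hKcard : (K.card : ℝ) ≤ 1.01 * X := by
    have h1 : K.card ≤ ⌊X + |(a : ℝ)|⌋₊ := (card_filter_le _ _).trans (by simp)
    have h2 : (K.card : ℝ) ≤ X + |(a : ℝ)| := (Nat.le_floor_iff (by positivity)).1 h1
    nlinarith
  have hGk : ((G.filter (fun d => r d k)).card : ℝ) ≤
      ((L.divisors.filter (fun d => r d k)).card : ℝ) := by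
    exact_mod_cast card_le_card (filter_subset_filter _ (filter_subset _ _))
  have hfin : (G.card : ℝ) / (8 * Real.log x) ≤ ((G.filter (fun d => r d k)).card : ℝ) := by
    have h1 : 0.16 * X / Real.log x * G.card ≤
        1.01 * X * ((G.filter (fun d => r d k)).card : ℝ) := hk.trans (by gcongr)
    have h2 : X * (0.16 / Real.log x * G.card) ≤
        X * (1.01 * ((G.filter (fun d => r d k)).card : ℝ)) := by
      calc _ = 0.16 * X / Real.log x * G.card := by ring
        _ ≤ _ := h1
        _ = _ := by ring
    have h3 := le_of_mul_le_mul_left h2 hX0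
    have h4 : 0.16 / Real.log x * (G.card : ℝ) = 1.28 * ((G.card : ℝ) / (8 * Real.log x)) := by
      field_simp; norm_num
    have h5 : 0 ≤ (G.card : ℝ) / (8 * Real.log x) := by positivity
    rw [h4] at h3
    linarith
  refine le_trans ?_ (hfin.trans hGk)
  have hpow : (2 : ℝ) ^ (-(D : ℤ) - (w : ℤ) - 3) = 1 / (8 * 2 ^ (D + w)) := by
    rw [show -(D : ℤ) - (w : ℤ) - 3 = -((D + w + 3 : ℕ) : ℤ) by push_cast; ring, zpow_neg,
      zpow_natCast, pow_add]
    norm_num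
    ring
  rw [hpow]
  calc 1 / (8 * 2 ^ (D + w)) / Real.log x *
        ((L.divisors.filter (fun d : ℕ => (d : ℝ) ≤ x ^ B)).card : ℝ)
      ≤ 1 / (8 * 2 ^ (D + w)) / Real.log x * (2 ^ (D + w) * (G.card : ℝ)) := by gcongr
    _ = (G.card : ℝ) / (8 * Real.log x) := by field_simp
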